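/- All graphs are finite and simple. In the domination game on a graph $G$, Dominator and Staller alternately choose a vertex so that at least one previously undominated vertex becomes dominated, where a vertex dominates itself and its neighbors; the game ends when all vertices are dominated. Dominator wants to minimize and Staller to maximize the total number of moves; $\gamma_g(G)$ is the number of moves when Dominator moves first and both play optimally. Let $n(G)$ denote the order of $G$ and let $\kappa'(G)$ denote its edge-connectivity, the smallest size of an edge cut of $G$ (a set of edges whose removal disconnects $G$). Theorem. Let $C$ be a minimum edge cut (an edge cut of smallest size) of a connected graph $G$, let $G_1$ and $G_2$ be the two components of $G\setminus C$, and let $q$ be a real number. If $$\gamma_g(G_2)\le q\cdot n(G_2)\quad\text{and}\quad \gamma_g(G_1)\le \frac{n(G_1)}{2}-\frac{(2q-1)\,n(G_2)}{2}-2\kappa'(G)-2,$$ then $\gamma_g(G)\le\lceil n(G)/2\rceil$. -/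

import Mathlib

namespace DominationGame

/-- The closed neighborhood `N[x]`: the vertex `x` together with its neighbors. The vertex `x`
dominates exactly the vertices of `N[x]`. -/
def closedNeighborhood {V : Type*} (G : SimpleGraph V) (x : V) : Set V :=
  {y | y = x ∨ G.Adj x y}

/-- Choosing `x` is legal when the vertices of `S` are already dominated: at least one previously
undominated vertex becomes dominated. -/
def IsLegalMove {V : Type*} (G : SimpleGraph V) (S : Set V) (x : V) : Prop :=
  ∃ y ∈ closedNeighborhood G x, y ∉ S

/-- The two players of the domination game. -/
inductive Player where
  | dominator
  | staller

open Classical in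
/-- The number of moves still to be played under optimal play on the partially dominated graph
`G|S` (the vertices of `S` are already dominated) when it is the turn of the given player.
The game is over when all vertices are dominated; otherwise the player to move chooses a legal
move, Dominator minimizing and Staller maximizing the total number of moves. There are finitely
many vertices, and a legal move exists as long as some vertex is undominated, so the infimum and
the supremum are a minimum and a maximum over a finite nonempty set. -/
noncomputable def optimalLength {V : Type*} [Finite V] (G : SimpleGraph V) (p : Player)
    (S : Set V) : ℕ :=
  if S = Set.univ then 0
  else
    match p with
    | .dominator => ⨅ x : {x : V // IsLegalMove G S x},
        (1 + optimalLength G .staller (S ∪ closedNeighborhood G x.1))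
    | .staller => ⨆ x : {x : V // IsLegalMove G S x},
        (1 + optimalLength G .dominator (S ∪ closedNeighborhood G x.1))
termination_by Sᶜ.ncard
decreasing_by
  all_goals
    obtain ⟨y, hy, hyS⟩ := x.2
    exact Set.ncard_lt_ncard
      ⟨Set.compl_subset_compl.mpr Set.subset_union_left, fun h => h hyS (Or.inr hy)⟩
      (Set.toFinite _)

/-- The game domination number `γ_g(G)`: the number of moves of the game in which Dominator moves
first and no vertex is dominated at the start, when both players play optimally. -/
noncomputable def gameDominationNumber {V : Type*} [Finite V] (G : SimpleGraph V) : ℕ :=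
  optimalLength G .dominator ∅

/-- An edge cut: a set of edges of `G` whose removal leaves a disconnected graph. -/
def IsEdgeCut {V : Type*} (G : SimpleGraph V) (C : Set (Sym2 V)) : Prop :=
  C ⊆ G.edgeSet ∧ ¬ (G.deleteEdges C).Connected

/-- A minimum edge cut: an edge cut of smallest cardinality. -/
def IsMinimumEdgeCut {V : Type*} (G : SimpleGraph V) (C : Set (Sym2 V)) : Prop :=
  IsEdgeCut G C ∧ ∀ D : Set (Sym2 V), IsEdgeCut G D → C.ncard ≤ D.ncard

/-- The edge-connectivity `κ'(G)` of a finite graph: the least cardinality of an edge cut. -/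
noncomputable def edgeConnectivity {V : Type*} (G : SimpleGraph V) : ℕ :=
  sInf {k : ℕ | ∃ C : Set (Sym2 V), IsEdgeCut G C ∧ C.ncard = k}

end DominationGame

namespace DominationGame

section Game

/-! ### Play on a fixed graph: optimal moves and continuation. -/

variable {V : Type*}

/-! Deleting an edge shortens the game by at most two moves
(`optimalLength_le_deleteEdges_singleton_add_two`), so deleting `C` costs at most `2κ'`. What
remains is a disjoint union of two graphs, on which Dominator answers Staller in the same part, at a
cost of at most two moves over the separate games (`gameDominationNumber_le_add_induce`). Hence
`γ_g(G) ≤ γ_g(G₁) + γ_g(G₂) + 2 + 2κ'`, and the two hypotheses are balanced so that the right side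
is at most `n(G)/2`. Minimality of `C` gives `|C| = κ'` and exactly two components. -/

theorem self_mem_closedNeighborhood (G : SimpleGraph V) (x : V) : x ∈ closedNeighborhood G x :=
  Or.inl rfl

theorem closedNeighborhood_mono {G H : SimpleGraph V} (h : H ≤ G) (x : V) :
    closedNeighborhood H x ⊆ closedNeighborhood G x :=
  fun _ hy => hy.imp id fun hxy => h hxy

theorem IsLegalMove.anti {G : SimpleGraph V} {S T : Set V} {x : V} (hST : S ⊆ T)
    (hx : IsLegalMove G T x) : IsLegalMove G S x :=
  let ⟨y, hy, hyT⟩ := hx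
  ⟨y, hy, fun h => hyT (hST h)⟩

theorem IsLegalMove.mono {G H : SimpleGraph V} (h : H ≤ G) {S : Set V} {x : V}
    (hx : IsLegalMove H S x) : IsLegalMove G S x :=
  let ⟨y, hy, hyS⟩ := hx
  ⟨y, closedNeighborhood_mono h x hy, hyS⟩

theorem IsLegalMove.ne_univ {G : SimpleGraph V} {S : Set V} {x : V} (hx : IsLegalMove G S x) :
    S ≠ Set.univ := by
  rintro rfl
  obtain ⟨y, -, hy⟩ := hx
  exact hy trivial

theorem exists_isLegalMove (G : SimpleGraph V) {S : Set V} (hS : S ≠ Set.univ) :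
    ∃ x, IsLegalMove G S x := by
  obtain ⟨x, hx⟩ := (Set.ne_univ_iff_exists_notMem S).1 hS
  exact ⟨x, x, self_mem_closedNeighborhood G x, hx⟩

theorem not_isLegalMove_iff {G : SimpleGraph V} {S : Set V} {x : V} :
    ¬ IsLegalMove G S x ↔ closedNeighborhood G x ⊆ S := by
  simp [IsLegalMove, Set.subset_def]

theorem closedNeighborhood_subset {H : SimpleGraph V} {A : Set V}
    (hA : ∀ x y, H.Adj x y → (x ∈ A ↔ y ∈ A)) {x : V} (hx : x ∈ A) :
    closedNeighborhood H x ⊆ A := by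
  rintro y (rfl | hy)
  · exact hx
  · exact (hA x y hy).1 hx

variable [Finite V]

theorem IsLegalMove.ncard_compl_lt {G : SimpleGraph V} {S : Set V} {x : V}
    (hx : IsLegalMove G S x) : (S ∪ closedNeighborhood G x)ᶜ.ncard < Sᶜ.ncard := by
  obtain ⟨y, hy, hyS⟩ := hx
  exact Set.ncard_lt_ncard
    ⟨Set.compl_subset_compl.mpr Set.subset_union_left, fun h => h hyS (Or.inr hy)⟩
    (Set.toFinite _)

/-- Induction over positions along legal moves. -/
theorem position_induction (G : SimpleGraph V) {P : Set V → Prop}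
    (step : ∀ S, (∀ x, IsLegalMove G S x → P (S ∪ closedNeighborhood G x)) → P S) (S : Set V) :
    P S := by
  induction hn : Sᶜ.ncard using Nat.strong_induction_on generalizing S with
  | _ n ih =>
    subst hn
    exact step S fun x hx => ih _ hx.ncard_compl_lt _ rfl

@[simp]
theorem optimalLength_univ (G : SimpleGraph V) (p : Player) :
    optimalLength G p Set.univ = 0 := by
  rw [optimalLength.eq_def, if_pos rfl]

theorem optimalLength_dominator_le {G : SimpleGraph V} {S : Set V} {x : V}
    (hx : IsLegalMove G S x) :
    optimalLength G .dominator S ≤ 1 + optimalLength G .staller (S ∪ closedNeighborhood G x) := by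
  rw [optimalLength, if_neg hx.ne_univ]
  exact ciInf_le' (fun x : {x : V // IsLegalMove G S x} =>
    1 + optimalLength G .staller (S ∪ closedNeighborhood G x.1)) ⟨x, hx⟩

theorem exists_optimal_dominator_move (G : SimpleGraph V) {S : Set V} (hS : S ≠ Set.univ) :
    ∃ x, IsLegalMove G S x ∧
      optimalLength G .dominator S =
        1 + optimalLength G .staller (S ∪ closedNeighborhood G x) := by
  obtain ⟨x, hx⟩ := exists_isLegalMove G hS
  have : Nonempty {x : V // IsLegalMove G S x} := ⟨⟨x, hx⟩⟩
  obtain ⟨y, hy⟩ := Nat.sInf_mem (Set.range_nonempty fun x : {x : V // IsLegalMove G S x} =>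
    1 + optimalLength G .staller (S ∪ closedNeighborhood G x.1))
  refine ⟨y.1, y.2, ?_⟩
  rw [optimalLength, if_neg hS]
  exact hy.symm

theorem le_optimalLength_staller {G : SimpleGraph V} {S : Set V} {x : V}
    (hx : IsLegalMove G S x) :
    1 + optimalLength G .dominator (S ∪ closedNeighborhood G x) ≤ optimalLength G .staller S := by
  rw [optimalLength.eq_def G .staller, if_neg hx.ne_univ]
  exact le_ciSup (f := fun x : {x : V // IsLegalMove G S x} =>
    1 + optimalLength G .dominator (S ∪ closedNeighborhood G x.1))
    (Set.finite_range _).bddAbove ⟨x, hx⟩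

theorem optimalLength_staller_le {G : SimpleGraph V} {S : Set V} {k : ℕ}
    (h : ∀ x, IsLegalMove G S x →
      1 + optimalLength G .dominator (S ∪ closedNeighborhood G x) ≤ k) :
    optimalLength G .staller S ≤ k := by
  by_cases hS : S = Set.univ
  · simp [hS]
  obtain ⟨x, hx⟩ := exists_isLegalMove G hS
  have : Nonempty {x : V // IsLegalMove G S x} := ⟨⟨x, hx⟩⟩
  rw [optimalLength, if_neg hS]
  exact ciSup_le fun x => h x.1 x.2

/-- The continuation principle: predominating more vertices never lengthens the game. -/
theorem optimalLength_anti (G : SimpleGraph V) (p : Player) {S T : Set V} (hST : S ⊆ T) :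
    optimalLength G p T ≤ optimalLength G p S := by
  induction S using position_induction G generalizing T p with
  | step S ih =>
    by_cases hT : T = Set.univ
    · simp [hT]
    have hS : S ≠ Set.univ := fun h => hT (Set.univ_subset_iff.1 (h ▸ hST))
    cases p with
    | dominator =>
      obtain ⟨x, hx, hxS⟩ := exists_optimal_dominator_move G hS
      -- Dominator copies the optimal move for `S`; if it is illegal it gains nothing beyond `T`,
      -- and any legal move will do.
      obtain ⟨y, hy, hsub⟩ : ∃ y, IsLegalMove G T y ∧
          S ∪ closedNeighborhood G x ⊆ T ∪ closedNeighborhood G y := by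
        by_cases hxT : IsLegalMove G T x
        · exact ⟨x, hxT, Set.union_subset_union_left _ hST⟩
        · obtain ⟨y, hy⟩ := exists_isLegalMove G hT
          exact ⟨y, hy, (Set.union_subset hST (not_isLegalMove_iff.1 hxT)).trans
            Set.subset_union_left⟩
      rw [hxS]
      exact (optimalLength_dominator_le hy).trans (Nat.add_le_add_left (ih x hx _ hsub) 1)
    | staller =>
      refine optimalLength_staller_le fun x hx => ?_
      have hxS := hx.anti hST
      exact (Nat.add_le_add_left (ih x hxS _ (Set.union_subset_union_left _ hST)) 1).trans
        (le_optimalLength_staller hxS)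

theorem optimalLength_dominator_le_staller_add_one (G : SimpleGraph V) (S : Set V) :
    optimalLength G .dominator S ≤ optimalLength G .staller S + 1 := by
  by_cases hS : S = Set.univ
  · simp [hS]
  obtain ⟨x, hx⟩ := exists_isLegalMove G hS
  have h := optimalLength_anti G .staller (S := S) (T := S ∪ closedNeighborhood G x)
    Set.subset_union_left
  have := optimalLength_dominator_le hx
  omega

theorem optimalLength_staller_le_dominator_add_one (G : SimpleGraph V) (S : Set V) :
    optimalLength G .staller S ≤ optimalLength G .dominator S + 1 := by
  refine optimalLength_staller_le fun x _ => ?_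
  have h := optimalLength_anti G .dominator (S := S) (T := S ∪ closedNeighborhood G x)
    Set.subset_union_left
  omega

/-- Two graphs whose closed neighborhoods agree outside `S` have the same game from `S` on; here
as an inequality. -/
theorem optimalLength_le_of_union_eq {G H : SimpleGraph V} (p : Player) {S : Set V}
    (h : ∀ x, S ∪ closedNeighborhood G x = S ∪ closedNeighborhood H x) :
    optimalLength G p S ≤ optimalLength H p S := by
  have legal : ∀ {S : Set V} {G H : SimpleGraph V},
      (∀ x, S ∪ closedNeighborhood G x = S ∪ closedNeighborhood H x) →
      ∀ x, IsLegalMove G S x → IsLegalMove H S x := by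
    rintro S G H h x ⟨y, hy, hyS⟩
    have : y ∈ S ∪ closedNeighborhood H x := h x ▸ Or.inr hy
    exact ⟨y, this.resolve_left hyS, hyS⟩
  induction S using position_induction H generalizing p with
  | step S ih =>
    have next : ∀ x, IsLegalMove H S x → ∀ p,
        optimalLength G p (S ∪ closedNeighborhood G x) ≤
          optimalLength H p (S ∪ closedNeighborhood H x) := by
      intro x hx p
      rw [h x]
      refine ih x hx p fun y => ?_
      rw [Set.union_right_comm, h y, Set.union_right_comm]
    by_cases hS : S = Set.univ
    · simp [hS]
    cases p with
    | dominator =>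
      obtain ⟨x, hx, hxS⟩ := exists_optimal_dominator_move H hS
      rw [hxS]
      exact (optimalLength_dominator_le (legal (fun x => (h x).symm) x hx)).trans
        (Nat.add_le_add_left (next x hx _) 1)
    | staller =>
      refine optimalLength_staller_le fun x hx => ?_
      have hxH := legal h x hx
      exact (Nat.add_le_add_left (next x hxH _) 1).trans (le_optimalLength_staller hxH)

/-! ### Deleting edges. -/

/-- Removing an edge shortens the game by at most two moves. -/
theorem optimalLength_le_deleteEdges_singleton_add_two (G : SimpleGraph V) (e : Sym2 V)
    (p : Player) (S : Set V) :
    optimalLength G p S ≤ optimalLength (G.deleteEdges {e}) p S + 2 := by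
  set H := G.deleteEdges {e} with hH
  have hle : H ≤ G := G.deleteEdges_le {e}
  induction S using position_induction H generalizing p with
  | step S ih =>
    by_cases hS : S = Set.univ
    · simp [hS]
    have next : ∀ x, IsLegalMove H S x → ∀ p,
        optimalLength G p (S ∪ closedNeighborhood G x) ≤
          optimalLength H p (S ∪ closedNeighborhood H x) + 2 := fun x hx p =>
      (optimalLength_anti G p
        (Set.union_subset_union_right S (closedNeighborhood_mono hle x))).trans (ih x hx p)
    cases p with
    | dominator =>
      obtain ⟨x, hx, hxS⟩ := exists_optimal_dominator_move H hS
      have h₁ := optimalLength_dominator_le (hx.mono hle)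
      have h₂ := next x hx .staller
      omega
    | staller =>
      refine optimalLength_staller_le fun x hx => ?_
      by_cases hxH : IsLegalMove H S x
      · have h₁ := le_optimalLength_staller hxH
        have h₂ := next x hxH .dominator
        omega
      -- Staller uses the deleted edge. This happens at most once: both ends are then dominated and
      -- the two games coincide. The cost is this move plus one for the change of turn.
      · obtain ⟨y, hy, hyS⟩ := hx
        have hsub := not_isLegalMove_iff.1 hxH
        have hyH : y ∉ closedNeighborhood H x := fun h => hyS (hsub h)
        have he : e = s(x, y) := by
          by_contra hne
          refine hyH (hy.imp id fun hxy => ?_)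
          rw [hH, SimpleGraph.deleteEdges_adj]
          exact ⟨hxy, fun h => hne (Set.mem_singleton_iff.1 h).symm⟩
        set T := S ∪ closedNeighborhood G x with hT
        have hend : ∀ z ∈ e, z ∈ T := by
          intro z hz
          rw [he, Sym2.mem_iff] at hz
          rcases hz with rfl | rfl
          · exact Or.inr (self_mem_closedNeighborhood G z)
          · exact Or.inr hy
        have heq : ∀ z, T ∪ closedNeighborhood G z = T ∪ closedNeighborhood H z := by
          intro z
          refine Set.Subset.antisymm ?_
            (Set.union_subset_union_right T (closedNeighborhood_mono hle z))
          rintro w (hw | hw | hw)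
          · exact Or.inl hw
          · exact Or.inr (Or.inl hw)
          · by_cases hzw : s(z, w) = e
            · exact Or.inl (hend w (hzw ▸ Sym2.mem_mk_right z w))
            · refine Or.inr (Or.inr ?_)
              rw [hH, SimpleGraph.deleteEdges_adj]
              exact ⟨hw, hzw⟩
        have h₁ := optimalLength_le_of_union_eq .dominator heq
        have h₂ := optimalLength_anti H .dominator (S := S) (T := T) Set.subset_union_left
        have h₃ := optimalLength_dominator_le_staller_add_one H S
        omega

theorem optimalLength_le_deleteEdges_add (G : SimpleGraph V) (C : Set (Sym2 V)) (p : Player)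
    (S : Set V) :
    optimalLength G p S ≤ optimalLength (G.deleteEdges C) p S + 2 * C.ncard := by
  induction C, Set.toFinite C using Set.Finite.induction_on with
  | empty => simp
  | @insert e C he hC ih =>
    have h := optimalLength_le_deleteEdges_singleton_add_two (G.deleteEdges C) e p S
    rw [SimpleGraph.deleteEdges_deleteEdges, Set.union_singleton] at h
    rw [Set.ncard_insert_of_notMem he hC]
    omega

/-! ### Disjoint unions. -/

/-- The game on a disjoint union of two parts, compared with the games on the two parts, each
expressed by predominating the other part. -/
theorem optimalLength_union_le {H : SimpleGraph V} {A : Set V}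
    (hA : ∀ x y, H.Adj x y → (x ∈ A ↔ y ∈ A)) (S : Set V) :
    optimalLength H .dominator S ≤ optimalLength H .dominator (S ∪ Aᶜ) +
        optimalLength H .dominator (S ∪ A) + 2 := by
  -- Both bounds are proved together, since each turn switches between them. Quantifying over `B`
  -- lets either part be the one where Staller has just moved and Dominator must reply.
  have main : ∀ S : Set V, ∀ B : Set V, (∀ x y, H.Adj x y → (x ∈ B ↔ y ∈ B)) →
      optimalLength H .staller S ≤
        optimalLength H .staller (S ∪ Bᶜ) + optimalLength H .staller (S ∪ B) + 1 ∧
      optimalLength H .dominator S ≤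
        optimalLength H .dominator (S ∪ Bᶜ) + optimalLength H .staller (S ∪ B) + 1 := by
    intro S
    induction S using position_induction H with
    | step S ih =>
      have outside : ∀ B : Set V, ∀ x, IsLegalMove H (S ∪ Bᶜ) x →
          (∀ x y, H.Adj x y → (x ∈ B ↔ y ∈ B)) → x ∈ B := by
        rintro B x hx hB
        by_contra hxB
        exact not_isLegalMove_iff.2 ((closedNeighborhood_subset
          (fun x y h => not_congr (hB x y h)) hxB).trans Set.subset_union_right) hx
      have moveIn : ∀ B : Set V, (∀ x y, H.Adj x y → (x ∈ B ↔ y ∈ B)) → ∀ x ∈ B,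
          IsLegalMove H S x →
          1 + optimalLength H .dominator (S ∪ closedNeighborhood H x) ≤
            optimalLength H .staller (S ∪ Bᶜ) + optimalLength H .staller (S ∪ B) + 1 := by
        intro B hB x hxB hx
        have hsub := closedNeighborhood_subset hB hxB
        have hlegal : IsLegalMove H (S ∪ Bᶜ) x := by
          obtain ⟨y, hy, hyS⟩ := hx
          exact ⟨y, hy, fun h => h.elim hyS fun h => h (hsub hy)⟩
        have h₁ := (ih x hx B hB).2
        have h₂ := le_optimalLength_staller hlegal
        have h₃ := optimalLength_anti H .staller (S := S ∪ B)
          (T := S ∪ closedNeighborhood H x ∪ B)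
          (Set.union_subset_union_left B Set.subset_union_left)
        rw [Set.union_right_comm] at h₂
        omega
      intro B hB
      constructor
      · refine optimalLength_staller_le fun x hx => ?_
        by_cases hxB : x ∈ B
        · exact moveIn B hB x hxB hx
        · have := moveIn Bᶜ (fun x y h => not_congr (hB x y h)) x hxB hx
          rw [compl_compl] at this
          omega
      -- If `B` is exhausted, Dominator cannot reply there and must open the other part; the extra 1
      -- pays for this.
      · by_cases hSB : S ∪ Bᶜ = Set.univ
        · have hBS : S ∪ B = S := by
            refine Set.union_eq_left.2 fun x hx => ?_
            exact (hSB.symm ▸ Set.mem_univ x : x ∈ S ∪ Bᶜ).resolve_right fun h => h hx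
          have := optimalLength_dominator_le_staller_add_one H S
          rw [hBS]
          omega
        · obtain ⟨x, hx, hxS⟩ := exists_optimal_dominator_move H hSB
          have hxl : IsLegalMove H S x := hx.anti Set.subset_union_left
          have h₁ := optimalLength_dominator_le hxl
          have h₂ := (ih x hxl B hB).1
          have h₃ := optimalLength_anti H .staller (S := S ∪ B)
            (T := S ∪ closedNeighborhood H x ∪ B)
            (Set.union_subset_union_left B Set.subset_union_left)
          rw [Set.union_right_comm] at hxS
          omega
  have h₁ := (main S A hA).2
  have h₂ := optimalLength_staller_le_dominator_add_one H (S ∪ A)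
  omega

/-- If everything outside a union `A` of components is dominated, only the game on `A` is left. -/
theorem optimalLength_le_induce {H : SimpleGraph V} {A : Set V}
    (hA : ∀ x y, H.Adj x y → (x ∈ A ↔ y ∈ A)) (p : Player) {S : Set V} (hS : Aᶜ ⊆ S) :
    optimalLength H p S ≤ optimalLength (H.induce A) p ((↑) ⁻¹' S : Set A) := by
  have mem_iff : ∀ x y : A,
      y ∈ closedNeighborhood (H.induce A) x ↔ y.1 ∈ closedNeighborhood H x.1 := by
    intro x y
    simp [closedNeighborhood, Subtype.ext_iff]
  induction S using position_induction H generalizing p with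
  | step S ih =>
    have next : ∀ x : A, IsLegalMove H S x → ∀ p,
        optimalLength H p (S ∪ closedNeighborhood H x) ≤ optimalLength (H.induce A) p
          ((↑) ⁻¹' S ∪ closedNeighborhood (H.induce A) x) := by
      intro x hx p
      convert ih x hx p (hS.trans Set.subset_union_left) using 2
      ext y
      simp [mem_iff]
    cases p with
    | dominator =>
      by_cases hSu : S = Set.univ
      · simp [hSu]
      have hSA : ((↑) ⁻¹' S : Set A) ≠ Set.univ := by
        intro h
        refine hSu (Set.eq_univ_of_forall fun x => ?_)
        by_cases hx : x ∈ A
        · exact (h.symm ▸ Set.mem_univ _ : (⟨x, hx⟩ : A) ∈ ((↑) ⁻¹' S : Set A))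
        · exact hS hx
      obtain ⟨x, hx, hxS⟩ := exists_optimal_dominator_move (H.induce A) hSA
      have hxH : IsLegalMove H S x := by
        obtain ⟨y, hy, hyS⟩ := hx
        exact ⟨y, (mem_iff x y).1 hy, hyS⟩
      rw [hxS]
      exact (optimalLength_dominator_le hxH).trans (Nat.add_le_add_left (next x hxH _) 1)
    | staller =>
      refine optimalLength_staller_le fun x hx => ?_
      obtain ⟨y, hy, hyS⟩ := hx
      have hyA : y ∈ A := by_contra fun h => hyS (hS h)
      have hxA : x ∈ A := hy.elim (fun h => h ▸ hyA) fun h => (hA x y h).2 hyA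
      have hxl : IsLegalMove (H.induce A) ((↑) ⁻¹' S) ⟨x, hxA⟩ :=
        ⟨⟨y, hyA⟩, (mem_iff ⟨x, hxA⟩ ⟨y, hyA⟩).2 hy, hyS⟩
      exact (Nat.add_le_add_left (next ⟨x, hxA⟩ ⟨y, hy, hyS⟩ _) 1).trans
        (le_optimalLength_staller hxl)

/-- The game on a disjoint union of two graphs is at most two moves longer than the two separate
games together. -/
theorem gameDominationNumber_le_add_induce {H : SimpleGraph V} {A B : Set V} (hAB : B = Aᶜ)
    (hA : ∀ x y, H.Adj x y → (x ∈ A ↔ y ∈ A)) :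
    gameDominationNumber H ≤
      gameDominationNumber (H.induce A) + gameDominationNumber (H.induce B) + 2 := by
  subst hAB
  have h := optimalLength_union_le hA ∅
  have h₁ := (optimalLength_le_induce hA .dominator subset_rfl).trans
    (optimalLength_anti (H.induce A) .dominator (Set.empty_subset _))
  have h₂ := (optimalLength_le_induce (fun x y h => not_congr (hA x y h)) .dominator
    (S := A) (compl_compl A).subset).trans
    (optimalLength_anti (H.induce Aᶜ) .dominator (Set.empty_subset _))
  rw [Set.empty_union, Set.empty_union] at h
  unfold gameDominationNumber
  omega

end Game

/-! ### Structure of minimum edge cuts. -/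

section EdgeCut

variable {V : Type*} {G : SimpleGraph V} {C : Set (Sym2 V)}

theorem IsMinimumEdgeCut.ncard_eq (hC : IsMinimumEdgeCut G C) :
    C.ncard = edgeConnectivity G := by
  refine le_antisymm (le_csInf ⟨_, C, hC.1, rfl⟩ ?_) (Nat.sInf_le ⟨C, hC.1, rfl⟩)
  rintro _ ⟨D, hD, rfl⟩
  exact hC.2 D hD

/-- Every edge of a minimum edge cut has exactly one end in a given component, if there is
another component. -/
theorem IsMinimumEdgeCut.mem_supp_iff_notMem [Finite V] (hC : IsMinimumEdgeCut G C)
    {K L : (G.deleteEdges C).ConnectedComponent} (hKL : K ≠ L) {x y : V} (hxy : s(x, y) ∈ C) :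
    x ∈ K.supp ↔ y ∉ K.supp := by
  -- The edges of `C` leaving `K` already separate `K` from `L`, so by minimality they are all of
  -- `C`.
  set D : Set (Sym2 V) := {e ∈ C | ∃ a ∈ K.supp, ∃ b ∉ K.supp, e = s(a, b)} with hD
  have hadj : ∀ a b, (G.deleteEdges D).Adj a b → a ∈ K.supp → b ∈ K.supp := by
    intro a b hab ha
    by_contra hb
    rw [SimpleGraph.deleteEdges_adj] at hab
    by_cases habC : s(a, b) ∈ C
    · exact hab.2 ⟨habC, a, ha, b, hb, rfl⟩
    · exact hb (K.mem_supp_of_adj_mem_supp ha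
        (SimpleGraph.deleteEdges_adj.2 ⟨hab.1, habC⟩))
  have hwalk : ∀ a b, (G.deleteEdges D).Reachable a b → a ∈ K.supp → b ∈ K.supp := by
    rintro a b ⟨w⟩
    induction w with
    | nil => exact id
    | cons h _ ih => exact fun ha => ih (hadj _ _ h ha)
  have hcut : IsEdgeCut G D := by
    refine ⟨fun e he => hC.1.1 he.1, fun hconn => ?_⟩
    obtain ⟨a, ha⟩ := K.nonempty_supp
    obtain ⟨b, hb⟩ := L.nonempty_supp
    have hbK := hwalk a b (hconn.preconnected a b) ha
    rw [SimpleGraph.ConnectedComponent.mem_supp_iff] at hb hbK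
    exact hKL (hbK.symm.trans hb)
  have hDC : D = C := Set.eq_of_subset_of_ncard_le (fun e he => he.1) (hC.2 D hcut)
  rw [← hDC] at hxy
  obtain ⟨-, a, ha, b, hb, hab⟩ := hxy
  rcases Sym2.eq_iff.1 hab with ⟨rfl, rfl⟩ | ⟨rfl, rfl⟩
  · exact iff_of_true ha hb
  · exact iff_of_false hb (not_not.2 ha)

/-- Removing a minimum edge cut from a connected graph leaves exactly two components. -/
theorem IsMinimumEdgeCut.supp_eq_compl [Finite V] (hG : G.Connected)
    (hC : IsMinimumEdgeCut G C) {K L : (G.deleteEdges C).ConnectedComponent} (hKL : K ≠ L) :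
    L.supp = K.suppᶜ := by
  ext z
  refine ⟨fun hL hK => hKL (hK.symm.trans hL), fun hK => ?_⟩
  by_contra hL
  have hne : C.Nonempty := by
    rw [Set.nonempty_iff_ne_empty]
    rintro rfl
    exact hC.1.2 (by simpa using hG)
  obtain ⟨e, he⟩ := hne
  induction e with
  | _ x y =>
    -- With a third component, an edge of `C` would need one end in each of three disjoint sets.
    set M := (G.deleteEdges C).connectedComponentMk z
    have hMK : M ≠ K := fun h => hK h
    have hML : M ≠ L := fun h => hL h
    have h₁ := hC.mem_supp_iff_notMem hKL he
    have h₂ := hC.mem_supp_iff_notMem hKL.symm he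
    have h₃ := hC.mem_supp_iff_notMem hMK he
    simp only [SimpleGraph.ConnectedComponent.mem_supp_iff] at h₁ h₂ h₃
    grind

end EdgeCut

end DominationGame

theorem theorem5p1 {V : Type*} [Finite V] (G : SimpleGraph V) (hG : G.Connected)
    (C : Set (Sym2 V)) (hC : DominationGame.IsMinimumEdgeCut G C)
    (G₁ G₂ : (G.deleteEdges C).ConnectedComponent) (hne : G₁ ≠ G₂) (q : ℝ)
    (h₂ : (DominationGame.gameDominationNumber G₂.toSimpleGraph : ℝ) ≤ q * (Nat.card G₂ : ℝ))
    (h₁ : (DominationGame.gameDominationNumber G₁.toSimpleGraph : ℝ) ≤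
      (Nat.card G₁ : ℝ) / 2 - (2 * q - 1) * (Nat.card G₂ : ℝ) / 2
        - 2 * (DominationGame.edgeConnectivity G : ℝ) - 2) :
    DominationGame.gameDominationNumber G ≤ ⌈(Nat.card V : ℝ) / 2⌉₊ := by
  have hcompl := hC.supp_eq_compl hG hne
  have hcard : Nat.card G₁ + Nat.card G₂ = Nat.card V := by
    have := Set.ncard_add_ncard_compl G₁.supp
    rwa [← hcompl] at this
  have hdel := DominationGame.optimalLength_le_deleteEdges_add G C .dominator ∅
  rw [hC.ncard_eq] at hdel
  have hunion : DominationGame.gameDominationNumber (G.deleteEdges C) ≤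
      DominationGame.gameDominationNumber G₁.toSimpleGraph +
        DominationGame.gameDominationNumber G₂.toSimpleGraph + 2 :=
    DominationGame.gameDominationNumber_le_add_induce hcompl
      fun x y h => G₁.mem_supp_congr_adj h
  have htotal : DominationGame.gameDominationNumber G ≤
      DominationGame.gameDominationNumber G₁.toSimpleGraph +
        DominationGame.gameDominationNumber G₂.toSimpleGraph + 2 +
        2 * DominationGame.edgeConnectivity G :=
    hdel.trans (Nat.add_le_add_right hunion _)
  have hcard' : (Nat.card G₁ : ℝ) + Nat.card G₂ = Nat.card V := by exact_mod_cast hcard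
  have htotal' : (DominationGame.gameDominationNumber G : ℝ) ≤
      DominationGame.gameDominationNumber G₁.toSimpleGraph +
        DominationGame.gameDominationNumber G₂.toSimpleGraph + 2 +
        2 * DominationGame.edgeConnectivity G := by exact_mod_cast htotal
  have hle : (DominationGame.gameDominationNumber G : ℝ) ≤ (Nat.card V : ℝ) / 2 := by
    linarith
  exact_mod_cast hle.trans (Nat.le_ceil _)
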